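/- Let $R$ be an (associative, unital) ring; "module" means right $R$-module. For a class $\mathcal C$ of modules, $\mathrm{Filt}(\mathcal C)$ denotes the class of all modules $N$ that possess a $\mathcal C$-filtration, i.e. an increasing chain of submodules $(N_\alpha\mid\alpha<\sigma)$, $\sigma>0$ an ordinal, such that $N_0=0$, $N=\bigcup_{\alpha<\sigma}N_\alpha$, $N_\alpha=\bigcup_{\beta<\alpha}N_\beta$ for each limit ordinal $\alpha<\sigma$, and $N_{\alpha+1}/N_\alpha$ is isomorphic to an element of $\mathcal C$ whenever $\alpha+1<\sigma$. For an infinite cardinal $\theta$, a module is $<\theta$-presented if it has a presentation with fewer than $\theta$ generators and fewer than $\theta$ relations, and a class $\mathcal D$ of modules is $\theta$-deconstructible if $\mathcal D=\mathrm{Filt}(\mathcal C)$ for some set $\mathcal C\subseteq\mathcal D$ of $<\theta$-presented modules. A module $M$ is a strong splitter if $\mathrm{Ext}^1_R(M,M^{(I)})=0$ for every set $I$. For an infinite cardinal $\mu$, $\mathcal D$ is $\mu$-categorical if it contains a module of cardinality $\mu$ and all modules of cardinality $\mu$ in $\mathcal D$ are isomorphic. Let $\mathcal D$ be a class of modules containing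 a nonzero strong splitter $M$, and let $\kappa$ be an infinite cardinal with $\kappa\ge|R|+|M|$ such that $\mathcal D$ is $\kappa^+$-deconstructible. Then for each cardinal $\lambda\ge\kappa$ the following conditions are equivalent: 1. $\mathcal D$ is $\mu$-categorical for each cardinal $\mu\ge\lambda$. 2. $\mathcal D$ is $\lambda$-categorical. 3. For each cardinal $\mu\ge\lambda$, every module in $\mathcal D$ of cardinality $\mu$ is isomorphic to $M^{(\mu)}$. -/

import Mathlib

open CategoryTheory Cardinal

universe u

/-- `X` is `< κ`-presented: it has a presentation by generators and relations with fewer than `κ`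
generators and fewer than `κ` relations. -/
def IsLTPresented {R : Type u} [Ring R] (κ : Cardinal.{u}) (X : ModuleCat.{u} R) : Prop :=
  ∃ P : Module.Presentation.{u, u} R X, #P.G < κ ∧ #P.R < κ

/-- `(F α ∣ α < σ)` is a `C`-filtration of the module `N`. Only the values `F α` with `α < σ`
matter. -/
structure IsTransfiniteFiltration {R : Type u} [Ring R] (C : ObjectProperty (ModuleCat.{u} R))
    (N : ModuleCat.{u} R) (σ : Ordinal.{u}) (F : Ordinal.{u} → Submodule R N) : Prop where
  pos : 0 < σ
  mono : ∀ α β : Ordinal.{u}, α ≤ β → β < σ → F α ≤ F β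
  zero : F 0 = ⊥
  union : (⋃ α : Set.Iio σ, (F α : Set N)) = Set.univ
  limit : ∀ α : Ordinal.{u}, α < σ → Order.IsSuccLimit α →
    (F α : Set N) = ⋃ β : Set.Iio α, (F β : Set N)
  succ : ∀ α : Ordinal.{u}, Order.succ α < σ →
    ∃ X : ModuleCat.{u} R, C X ∧
      Nonempty ((F (Order.succ α) ⧸ (F α).submoduleOf (F (Order.succ α))) ≃ₗ[R] X)

/-- The class of all transfinite extensions of modules from `C` (the `C`-filtered modules). -/
def Filt {R : Type u} [Ring R] (C : ObjectProperty (ModuleCat.{u} R)) :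
    ObjectProperty (ModuleCat.{u} R) :=
  fun N => ∃ (σ : Ordinal.{u}) (F : Ordinal.{u} → Submodule R N), IsTransfiniteFiltration C N σ F

/-- `D` is `κ`-deconstructible: `κ` is infinite, and `D` consists of the `C`-filtered modules for
some set (as opposed to a proper class) `C ⊆ D` of `< κ`-presented modules. -/
def IsDeconstructible {R : Type u} [Ring R] (κ : Cardinal.{u})
    (D : ObjectProperty (ModuleCat.{u} R)) : Prop :=
  ℵ₀ ≤ κ ∧ ∃ C : ObjectProperty (ModuleCat.{u} R), ObjectProperty.Small.{u} C ∧ C ≤ D ∧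
    (∀ X, C X → IsLTPresented κ X) ∧ D = Filt C

/-- The direct sum `M^(I)` of copies of `M` indexed by `I`. -/
noncomputable abbrev copower {R : Type u} [Ring R] (M : ModuleCat.{u} R) (I : Type u) : ModuleCat.{u} R :=
  ModuleCat.of R (I →₀ M)

/-- `M` is a strong splitter: `Ext¹(M, M^(I)) = 0` for every set `I`. -/
def IsStrongSplitter {R : Type u} [Ring R] (M : ModuleCat.{u} R) : Prop :=
  ∀ I : Type u, Subsingleton (Abelian.Ext.{u} M (copower M I) 1)

/-- `D` is `μ`-categorical (used for infinite `μ`): it contains a module of cardinality `μ`, and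
all its modules of cardinality `μ` are isomorphic. -/
def IsCategoricalIn {R : Type u} [Ring R] (D : ObjectProperty (ModuleCat.{u} R))
    (μ : Cardinal.{u}) : Prop :=
  (∃ N : ModuleCat.{u} R, D N ∧ #N = μ) ∧
    ∀ N N' : ModuleCat.{u} R, D N → D N' → #N = μ → #N' = μ → Nonempty (N ≃ₗ[R] N')

/-! The proof replaces ordinal filtrations by filtrations indexed by arbitrary well-ordered sets
(`hasTower_of_filt`, `HasTower.filt`). In that form a direct sum of filtered modules is visibly
filtered, by concatenating the filtrations (`hasTower_directSum`), so the class `D = Filt C` is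
closed under direct sums; in particular it contains all `M^(I)`.

Suppose that `D` is categorical in `l`. For `X` in `C` both `X ⊕ M^(l)` and `M^(l)` lie in `D` and
have cardinality `l`, so they are isomorphic and `X` is a direct summand of `M^(l)`
(`isCopowerRetract_of_isCategoricalIn`). As `M` is a strong splitter, extensions of direct summands
of sums of copies of `M` by one another split (`IsCopowerRetract.liftsAlong`). By transfinite
induction every filtration of a module `N` in `D` splits, and `N` is a direct sum of members of `C`
(`HasTower.exists_directSum`), each of cardinality at most `l`. If the cardinality `μ` of `N` is
larger than `l`, there are `μ` nonzero summands; grouped into `μ` blocks of `l` summands, they give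
`μ` modules of `D` of cardinality `l`, which are all isomorphic to `M^(l)`. Hence `N ≅ M^(μ)`.
-/

/-! ### Filtrations indexed by well-ordered sets -/

section Tower

variable {S : Type u} [Ring S] {N : Type u} [AddCommGroup N] [Module S N]

/-- The join of the members of a family of submodules with index strictly below `w`. -/
def strictSup {W : Type*} [Preorder W] (F : W → Submodule S N) (w : W) : Submodule S N :=
  ⨆ v : Set.Iio w, F v

lemma mem_strictSup {W : Type*} [LinearOrder W] {F : W → Submodule S N} (hF : Monotone F) {w : W}
    {x : N} : x ∈ strictSup F w ↔ x = 0 ∨ ∃ v < w, x ∈ F v := by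
  constructor
  · intro hx
    by_cases h : Nonempty (Set.Iio w)
    · rw [strictSup, Submodule.mem_iSup_of_directed] at hx
      · obtain ⟨v, hv⟩ := hx
        exact Or.inr ⟨v, v.2, hv⟩
      · exact Monotone.directed_le fun a b hab => hF hab
    · rw [not_nonempty_iff] at h
      rw [strictSup, iSup_of_empty] at hx
      exact Or.inl hx
  · rintro (rfl | ⟨v, hv, hx⟩)
    · exact zero_mem _
    · exact Submodule.mem_iSup_of_mem (⟨v, hv⟩ : Set.Iio w) hx

/-- A filtration of `N` with factors in `C`, indexed by a well-ordered set `W`. The index `w` marks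
the module reached after the `w`-th step, so the `w`-th factor is `F w` modulo `strictSup F w`; it is
presented by a surjection from `F w` onto a member of `C`. -/
structure IsTower (C : ObjectProperty (ModuleCat.{u} S)) {W : Type u} [LinearOrder W]
    (F : W → Submodule S N) : Prop where
  mono : Monotone F
  exists_mem : ∀ x, x ≠ 0 → ∃ w, x ∈ F w
  step : ∀ w, ∃ X : ModuleCat.{u} S, C X ∧ ∃ p : F w →ₗ[S] X, Function.Surjective p ∧
    ∀ b, p b = 0 ↔ (b : N) ∈ strictSup F w

/-- `N` admits a filtration with factors in `C` indexed by some well-ordered set. -/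
def HasTower (C : ObjectProperty (ModuleCat.{u} S)) (N : Type u) [AddCommGroup N] [Module S N] :
    Prop :=
  ∃ (W : Type u) (_ : LinearOrder W) (_ : WellFoundedLT W) (F : W → Submodule S N), IsTower C F

lemma HasTower.of_equiv {C : ObjectProperty (ModuleCat.{u} S)} {N' : Type u} [AddCommGroup N']
    [Module S N'] (e : N ≃ₗ[S] N') (h : HasTower C N) : HasTower C N' := by
  obtain ⟨W, _, _, F, hF⟩ := h
  have mono : Monotone fun w => (F w).comap e.symm.toLinearMap :=
    fun a b hab => Submodule.comap_mono (hF.mono hab)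
  refine ⟨W, _, ‹_›, fun w => (F w).comap e.symm.toLinearMap, mono, ?_, ?_⟩
  · intro x hx
    exact hF.exists_mem (e.symm x) (by simpa using hx)
  · intro w
    obtain ⟨X, hX, p, hp, hp0⟩ := hF.step w
    refine ⟨X, hX, p ∘ₗ e.symm.toLinearMap.restrict (fun x hx => hx), ?_, ?_⟩
    · intro y
      obtain ⟨b, rfl⟩ := hp y
      exact ⟨⟨e b, by simp⟩, congrArg p (Subtype.ext (by simp))⟩
    · intro b
      rw [mem_strictSup mono]
      refine (hp0 _).trans ?_
      rw [mem_strictSup hF.mono]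
      simp

lemma hasTower_of_filt {C : ObjectProperty (ModuleCat.{u} S)} {N : ModuleCat.{u} S}
    (h : Filt C N) : HasTower C N := by
  obtain ⟨σ, F, hF⟩ := h
  let o : {w : σ.ToType // Order.succ (Ordinal.ToType.toOrd w : Ordinal) < σ} → Ordinal.{u} :=
    fun w => (Ordinal.ToType.toOrd w.1 : Ordinal)
  have o_lt : ∀ v w, o v < o w ↔ v < w := fun v w => by
    simp only [o, Subtype.coe_lt_coe, OrderIso.lt_iff_lt]
  have o_surj : ∀ α, Order.succ α < σ → ∃ w, o w = α := fun α hα => by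
    refine ⟨⟨Ordinal.ToType.mk ⟨α, (Order.lt_succ α).trans hα⟩, by simpa using hα⟩, by simp [o]⟩
  have key : ∀ α < σ, ∀ x : N, x ∈ F α ↔ x = 0 ∨ ∃ v, o v < α ∧ x ∈ F (Order.succ (o v)) := by
    intro α hα x
    constructor
    · intro hx
      rcases Ordinal.zero_or_succ_or_isSuccLimit α with rfl | ⟨β, rfl⟩ | hl
      · rw [hF.zero] at hx
        exact Or.inl hx
      · obtain ⟨v, rfl⟩ := o_surj β hα
        exact Or.inr ⟨v, Order.lt_succ _, hx⟩
      · rw [← SetLike.mem_coe, hF.limit α hα hl, Set.mem_iUnion] at hx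
        obtain ⟨⟨β, hβ⟩, hx⟩ := hx
        have hs : Order.succ β < σ := (hl.succ_lt hβ).trans hα
        obtain ⟨v, rfl⟩ := o_surj β hs
        exact Or.inr ⟨v, hβ, hF.mono _ _ (Order.le_succ _) hs hx⟩
    · rintro (rfl | ⟨v, hv, hx⟩)
      · exact zero_mem _
      · exact hF.mono _ _ (Order.succ_le_of_lt hv) hα hx
  have mono : Monotone fun w => F (Order.succ (o w)) := by
    intro a b hab
    refine hF.mono _ _ (Order.succ_le_succ ?_) b.2
    exact le_of_not_gt fun hlt => absurd ((o_lt _ _).1 hlt) (not_lt.2 hab)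
  have sup_eq : ∀ w, strictSup (fun w => F (Order.succ (o w))) w = F (o w) := by
    intro w
    ext x
    rw [mem_strictSup mono, key _ ((Order.lt_succ _).trans w.2)]
    exact or_congr_right (exists_congr fun v => and_congr_left' (o_lt v w).symm)
  refine ⟨_, inferInstance, inferInstance, fun w => F (Order.succ (o w)), mono, ?_, ?_⟩
  · intro x hx
    have : x ∈ ⋃ α : Set.Iio σ, (F α : Set N) := hF.union ▸ Set.mem_univ x
    obtain ⟨⟨α, hα⟩, hxα⟩ := Set.mem_iUnion.1 this
    obtain rfl | ⟨v, -, hv⟩ := (key α hα x).1 hxα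
    · exact absurd rfl hx
    · exact ⟨v, hv⟩
  · intro w
    obtain ⟨X, hX, ⟨e⟩⟩ := hF.succ (o w) w.2
    refine ⟨X, hX, e.toLinearMap ∘ₗ Submodule.mkQ _, ?_, ?_⟩
    · exact e.surjective.comp (Submodule.mkQ_surjective _)
    · intro b
      rw [sup_eq]
      rw [LinearMap.comp_apply, LinearEquiv.coe_coe, LinearEquiv.map_eq_zero_iff]
      exact Submodule.Quotient.mk_eq_zero _

lemma HasTower.filt {C : ObjectProperty (ModuleCat.{u} S)} {N : ModuleCat.{u} S}
    (h : HasTower C N) : Filt C N := by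
  obtain ⟨W, _, _, F, hF⟩ := h
  let r : W → Ordinal.{u} := Ordinal.typein (α := W) (· < ·)
  have r_lt : ∀ v w, r v < r w ↔ v < w := fun v w => Ordinal.typein_lt_typein (α := W) (· < ·)
  let τ : Ordinal.{u} := Ordinal.type (α := W) (· < ·)
  have r_lt_τ : ∀ w, r w < τ := Ordinal.typein_lt_type (α := W) (· < ·)
  have r_surj : ∀ α < τ, ∃ w, r w = α := fun α hα => Ordinal.typein_surj (α := W) (· < ·) hα
  let G : Ordinal.{u} → Submodule S N := fun α => ⨆ v : {v // r v < α}, F v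
  have mem_G : ∀ α x, x ∈ G α ↔ x = 0 ∨ ∃ v, r v < α ∧ x ∈ F v := by
    intro α x
    constructor
    · intro hx
      by_cases h : Nonempty {v // r v < α}
      · simp only [G] at hx
        rw [Submodule.mem_iSup_of_directed] at hx
        · obtain ⟨v, hv⟩ := hx
          exact Or.inr ⟨v, v.2, hv⟩
        · exact Monotone.directed_le fun a b hab => hF.mono hab
      · rw [not_nonempty_iff] at h
        simp only [G] at hx
        rw [iSup_of_empty] at hx
        exact Or.inl hx
    · rintro (rfl | ⟨v, hv, hx⟩)
      · exact zero_mem _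
      · exact Submodule.mem_iSup_of_mem (⟨v, hv⟩ : {v // r v < α}) hx
  have G_mono : ∀ α β, α ≤ β → G α ≤ G β := by
    intro α β hab x hx
    rw [mem_G] at hx ⊢
    exact hx.imp_right fun ⟨v, hv, h⟩ => ⟨v, hv.trans_le hab, h⟩
  have G_r : ∀ w, G (r w) = strictSup F w := by
    intro w
    ext x
    rw [mem_G, mem_strictSup hF.mono]
    simp only [r_lt]
  have G_succ : ∀ w, G (Order.succ (r w)) = F w := by
    intro w
    ext x
    rw [mem_G]
    constructor
    · rintro (rfl | ⟨v, hv, hx⟩)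
      · exact zero_mem _
      · refine hF.mono (le_of_not_gt fun hlt => ?_) hx
        exact absurd ((r_lt _ _).2 hlt) (not_lt.2 (Order.lt_succ_iff.1 hv))
    · exact fun hx => Or.inr ⟨w, Order.lt_succ _, hx⟩
  refine ⟨Order.succ τ, G, zero_le.trans_lt (Order.lt_succ τ), fun α β h _ => G_mono α β h,
    ?_, ?_, ?_, ?_⟩
  · rw [eq_bot_iff]
    intro x hx
    obtain rfl | ⟨v, hv, -⟩ := (mem_G _ _).1 hx
    · exact zero_mem _
    · exact absurd hv not_lt_zero
  · refine Set.eq_univ_of_forall fun x => Set.mem_iUnion.2 ⟨⟨τ, Order.lt_succ τ⟩, ?_⟩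
    refine (mem_G _ _).2 (or_iff_not_imp_left.2 fun hx => ?_)
    obtain ⟨w, hw⟩ := hF.exists_mem x hx
    exact ⟨w, r_lt_τ w, hw⟩
  · intro α _ hl
    ext x
    rw [Set.mem_iUnion]
    constructor
    · intro hx
      obtain rfl | ⟨v, hv, hx⟩ := (mem_G _ _).1 hx
      · exact ⟨⟨0, pos_iff_ne_zero.2 (Ordinal.isSuccLimit_iff.1 hl).1⟩, zero_mem _⟩
      · exact ⟨⟨Order.succ (r v), hl.succ_lt hv⟩, (G_succ v).symm ▸ hx⟩
    · rintro ⟨⟨β, hβ⟩, hx⟩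
      exact G_mono β α (le_of_lt hβ) hx
  · intro α hα
    obtain ⟨w, rfl⟩ := r_surj α (Order.succ_lt_succ_iff.1 hα)
    obtain ⟨X, hX, p, hp, hp0⟩ := hF.step w
    rw [G_succ, G_r]
    refine ⟨X, hX, ⟨(Submodule.quotEquivOfEq _ _ ?_).trans (p.quotKerEquivOfSurjective hp)⟩⟩
    ext b
    rw [LinearMap.mem_ker, hp0]
    rfl

/-- A direct sum of modules with towers has a tower: run through the towers of the summands one
after another, along a well-order of the index set. -/
lemma hasTower_directSum {C : ObjectProperty (ModuleCat.{u} S)} {I : Type u} (N : I → Type u)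
    [∀ i, AddCommGroup (N i)] [∀ i, Module S (N i)] (h : ∀ i, HasTower C (N i)) :
    HasTower C (DirectSum I N) := by
  classical
  choose W hW hW' F hF using h
  obtain ⟨_, _⟩ := exists_wellFoundedLT I
  let G : (Σₗ i, W i) → Submodule S (DirectSum I N) := fun a =>
    { carrier := {x | (∀ j, (ofLex a).1 < j → x j = 0) ∧ x (ofLex a).1 ∈ F _ (ofLex a).2}
      add_mem' := fun {x y} hx hy => ⟨fun j hj => by
        rw [DirectSum.add_apply, hx.1 j hj, hy.1 j hj, add_zero], by
        rw [DirectSum.add_apply]; exact add_mem hx.2 hy.2⟩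
      zero_mem' := ⟨fun j _ => rfl, zero_mem (F _ (ofLex a).2)⟩
      smul_mem' := fun c x hx => ⟨fun j hj => by
        rw [DirectSum.smul_apply, hx.1 j hj, smul_zero], by
        rw [DirectSum.smul_apply]; exact Submodule.smul_mem _ c hx.2⟩ }
  have mem_G : ∀ i w x, x ∈ G (toLex ⟨i, w⟩) ↔ (∀ j, i < j → x j = 0) ∧ x i ∈ F i w :=
    fun _ _ _ => Iff.rfl
  have mono : Monotone G := by
    rintro ⟨i, v⟩ ⟨j, w⟩ hab x hx
    obtain ⟨h1, h2⟩ := (mem_G i v x).1 hx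
    refine (mem_G j w x).2 ?_
    rcases Sigma.Lex.le_def.1 hab with hij | ⟨hij, hvw⟩
    · exact ⟨fun k hk => h1 k (hij.trans hk), by rw [h1 j hij]; exact zero_mem _⟩
    · obtain rfl : i = j := hij
      exact ⟨h1, (hF i).mono hvw h2⟩
  -- The largest index of the support decides which members of the tower contain an element.
  have exists_top : ∀ x : DirectSum I N, x ≠ 0 → ∃ i, x i ≠ 0 ∧ ∀ j, i < j → x j = 0 := by
    intro x hx
    have hne : (DFinsupp.support x).Nonempty :=
      Finset.nonempty_iff_ne_empty.2 fun h => hx (DFinsupp.support_eq_empty.1 h)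
    refine ⟨(DFinsupp.support x).max' hne, ?_, fun j hj => ?_⟩
    · exact DFinsupp.mem_support_iff.1 ((DFinsupp.support x).max'_mem hne)
    · by_contra hxj
      exact absurd ((DFinsupp.support x).le_max' j (DFinsupp.mem_support_iff.2 hxj)) (not_le.2 hj)
  have sup : ∀ i w x, x ∈ strictSup G (toLex ⟨i, w⟩) ↔
      (∀ j, i < j → x j = 0) ∧ x i ∈ strictSup (F i) w := by
    intro i w x
    rw [mem_strictSup mono, mem_strictSup (hF i).mono]
    constructor
    · rintro (rfl | ⟨⟨j, v⟩, hv, hx⟩)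
      · exact ⟨fun _ _ => rfl, Or.inl rfl⟩
      · obtain ⟨h1, h2⟩ := (mem_G j v x).1 hx
        rcases Sigma.Lex.lt_def.1 hv with hij | ⟨hij, hvw⟩
        · exact ⟨fun k hk => h1 k (lt_trans hij hk), Or.inl (h1 i hij)⟩
        · obtain rfl : j = i := hij
          exact ⟨h1, Or.inr ⟨v, hvw, h2⟩⟩
    · rintro ⟨h1, h2⟩
      refine or_iff_not_imp_left.2 fun hx0 => ?_
      rcases h2 with h2 | ⟨v, hv, h2⟩
      · obtain ⟨j, hj, hj'⟩ := exists_top x hx0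
        have hji : j < i := by
          rcases lt_trichotomy j i with h | rfl | h
          · exact h
          · exact absurd h2 hj
          · exact absurd (h1 j h) hj
        obtain ⟨v, hv⟩ := (hF j).exists_mem _ hj
        exact ⟨toLex ⟨j, v⟩, Sigma.Lex.lt_def.2 (Or.inl hji), hj', hv⟩
      · exact ⟨toLex ⟨i, v⟩, Sigma.Lex.lt_def.2 (Or.inr ⟨rfl, hv⟩), h1, h2⟩
  have wf : WellFoundedLT (Σₗ i, W i) := ⟨by
    refine WellFounded.mono (r := InvImage (PSigma.Lex (· < ·) fun i => ((· < ·) : W i → W i → Prop))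
      (fun a => (⟨(ofLex a).1, (ofLex a).2⟩ : Σ' i, W i))) (InvImage.wf _
      (WellFounded.psigma_lex wellFounded_lt fun i => wellFounded_lt)) ?_
    rintro ⟨i, v⟩ ⟨j, w⟩ h
    rcases Sigma.Lex.lt_def.1 h with hij | ⟨hij, hvw⟩
    · exact PSigma.Lex.left _ _ hij
    · obtain rfl : i = j := hij
      exact PSigma.Lex.right _ hvw⟩
  refine ⟨Σₗ i, W i, inferInstance, wf, G, mono, ?_, ?_⟩
  · intro x hx
    obtain ⟨i, hi, hi'⟩ := exists_top x hx
    obtain ⟨w, hw⟩ := (hF i).exists_mem _ hi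
    exact ⟨toLex ⟨i, w⟩, hi', hw⟩
  · rintro ⟨i, w⟩
    obtain ⟨X, hX, p, hp, hp0⟩ := (hF i).step w
    refine ⟨X, hX, p ∘ₗ (DirectSum.component S I N i).restrict
      (p := G (toLex ⟨i, w⟩)) (fun x hx => hx.2), ?_, ?_⟩
    · intro y
      obtain ⟨b, rfl⟩ := hp y
      refine ⟨⟨DirectSum.of N i b, fun j hj => DirectSum.of_eq_of_ne _ _ _ hj.ne', ?_⟩, ?_⟩
      · change DirectSum.of N i (b : N i) i ∈ F i w
        rw [DirectSum.of_eq_same]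
        exact b.2
      · exact congrArg p (Subtype.ext (DirectSum.of_eq_same _ _))
    · intro b
      refine (hp0 _).trans ((sup i w b).trans (and_iff_right b.2.1)).symm

end Tower

/-! ### Splitting of extensions -/

section Lifting

variable {S : Type u} [Ring S]

/-- Every homomorphism from `Y` lifts along every surjection whose kernel is a copy of `A`, embedded
by `i`. Up to the choice of the target this is the vanishing of `Ext¹(Y, A)`. -/
def LiftsAlong (Y A : Type u) [AddCommGroup Y] [Module S Y] [AddCommGroup A] [Module S A] : Prop :=
  ∀ (B Z : Type u) [AddCommGroup B] [Module S B] [AddCommGroup Z] [Module S Z]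
    (i : A →ₗ[S] B) (f : B →ₗ[S] Z), Function.Injective i → Function.Surjective f →
    Function.Exact i f → ∀ g : Y →ₗ[S] Z, ∃ h : Y →ₗ[S] B, f ∘ₗ h = g

variable {Y A Y' A' : Type u} [AddCommGroup Y] [Module S Y] [AddCommGroup A] [Module S A]
  [AddCommGroup Y'] [Module S Y'] [AddCommGroup A'] [Module S A']

lemma liftsAlong_of_ext (M A : ModuleCat.{u} S) (h : Subsingleton (Abelian.Ext.{u} M A 1)) :
    LiftsAlong (S := S) M A := by
  intro B Z _ _ _ _ i f hi hf hif g
  have hS : (ModuleCat.shortComplexOfCompEqZero i f hif.linearMap_comp_eq_zero).ShortExact :=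
    ModuleCat.shortComplex_shortExact _ hif hi hf
  obtain ⟨x, hx⟩ := Abelian.Ext.covariant_sequence_exact₃ M hS
    (Abelian.Ext.mk₀ (ModuleCat.ofHom g)) rfl (Subsingleton.elim (α := Abelian.Ext M A 1) _ _)
  obtain ⟨k, rfl⟩ := Abelian.Ext.homEquiv₀.symm.surjective x
  refine ⟨k.hom, ?_⟩
  have hk : k ≫ ModuleCat.ofHom f = ModuleCat.ofHom g := by
    apply Abelian.Ext.homEquiv₀.symm.injective
    exact (Abelian.Ext.mk₀_comp_mk₀ _ _).symm.trans hx
  exact congrArg ModuleCat.Hom.hom hk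

lemma LiftsAlong.finsupp (h : LiftsAlong (S := S) Y A) (J : Type u) :
    LiftsAlong (S := S) (J →₀ Y) A := by
  intro B Z _ _ _ _ i f hi hf hif g
  choose k hk using fun j => h B Z i f hi hf hif (g ∘ₗ Finsupp.lsingle j)
  refine ⟨Finsupp.lsum ℕ k, ?_⟩
  ext j y
  simpa using LinearMap.congr_fun (hk j) y

lemma LiftsAlong.of_retract_left (h : LiftsAlong (S := S) Y A) (s : Y' →ₗ[S] Y) (r : Y →ₗ[S] Y')
    (hrs : r ∘ₗ s = LinearMap.id) : LiftsAlong (S := S) Y' A := by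
  intro B Z _ _ _ _ i f hi hf hif g
  obtain ⟨k, hk⟩ := h B Z i f hi hf hif (g ∘ₗ r)
  exact ⟨k ∘ₗ s, by rw [← LinearMap.comp_assoc, hk, LinearMap.comp_assoc, hrs, LinearMap.comp_id]⟩

lemma LiftsAlong.of_retract_right (h : LiftsAlong (S := S) Y A) (s : A' →ₗ[S] A) (r : A →ₗ[S] A')
    (hrs : r ∘ₗ s = LinearMap.id) : LiftsAlong (S := S) Y A' := by
  intro B Z _ _ _ _ i f hi hf hif g
  have hrs' : ∀ a, r (s a) = a := LinearMap.congr_fun hrs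
  -- Adding the complement `ker r` of `A'` in `A` to `B` turns the kernel `A'` into `A`.
  let q : A →ₗ[S] LinearMap.ker r := (LinearMap.id - s ∘ₗ r).codRestrict _ fun a => by simp [hrs']
  have hq : ∀ a, (q a : A) = a - s (r a) := fun a => rfl
  obtain ⟨k, hk⟩ := h (B × LinearMap.ker r) Z ((i ∘ₗ r).prod q) (f ∘ₗ LinearMap.fst S _ _)
    (by
      rw [← LinearMap.ker_eq_bot, LinearMap.ker_eq_bot']
      intro a ha
      obtain ⟨h1, h2⟩ := Prod.ext_iff.1 ha
      have h1 : r a = 0 := hi (by simpa using h1)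
      have h2 : (q a : A) = 0 := congrArg Subtype.val h2
      rwa [hq, h1, map_zero, sub_zero] at h2)
    (fun z => by obtain ⟨b, rfl⟩ := hf z; exact ⟨(b, 0), rfl⟩)
    (by
      rintro ⟨b, c⟩
      constructor
      · intro hb
        obtain ⟨a, rfl⟩ := (hif b).1 hb
        have hc : r c = 0 := c.2
        refine ⟨s a + c, Prod.ext (by simp [hrs', hc]) (Subtype.ext ?_)⟩
        change ((q (s a + c) : _) : A) = c
        rw [hq]
        simp [hrs', hc]
      · rintro ⟨a, ha⟩
        rw [← ha]
        exact hif.apply_apply_eq_zero _) g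
  exact ⟨LinearMap.fst S _ _ ∘ₗ k, hk⟩

/-- `X` is a direct summand of a direct sum of copies of `M`. -/
def IsCopowerRetract (M X : Type u) [AddCommGroup M] [Module S M] [AddCommGroup X] [Module S X] :
    Prop :=
  ∃ (J : Type u) (s : X →ₗ[S] (J →₀ M)) (r : (J →₀ M) →ₗ[S] X), r ∘ₗ s = LinearMap.id

lemma isCopowerRetract_directSum (M : Type u) [AddCommGroup M] [Module S M] {I : Type u}
    (X : I → Type u) [∀ i, AddCommGroup (X i)] [∀ i, Module S (X i)]
    (h : ∀ i, IsCopowerRetract (S := S) M (X i)) :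
    IsCopowerRetract (S := S) M (DirectSum I X) := by
  classical
  choose J s r hrs using h
  let r' : ((Σ i, J i) →₀ M) →ₗ[S] DirectSum I X := Finsupp.lsum ℕ fun a =>
    DirectSum.lof S I X a.1 ∘ₗ r a.1 ∘ₗ Finsupp.lsingle a.2
  have hr' : ∀ i, r' ∘ₗ Finsupp.lmapDomain M S (Sigma.mk i) = DirectSum.lof S I X i ∘ₗ r i := by
    intro i
    ext j m
    simp [r']
  refine ⟨Σ i, J i, DirectSum.toModule S I _ fun i => Finsupp.lmapDomain M S (Sigma.mk i) ∘ₗ s i,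
    r', ?_⟩
  refine DirectSum.linearMap_ext S fun i => ?_
  ext1 x
  have h1 := LinearMap.congr_fun (hr' i) (s i x)
  have h2 := LinearMap.congr_fun (hrs i) x
  simp only [LinearMap.comp_apply, LinearMap.id_apply] at h1 h2
  simp only [LinearMap.comp_apply, DirectSum.toModule_lof, h1, h2, LinearMap.id_apply]

lemma IsCopowerRetract.liftsAlong {M : Type u} [AddCommGroup M] [Module S M]
    (hM : ∀ I : Type u, LiftsAlong (S := S) M (I →₀ M)) (hY : IsCopowerRetract (S := S) M Y)
    (hA : IsCopowerRetract (S := S) M A) : LiftsAlong (S := S) Y A := by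
  obtain ⟨J, s, r, hrs⟩ := hY
  obtain ⟨I, s', r', hrs'⟩ := hA
  exact (((hM I).finsupp J).of_retract_left s r hrs).of_retract_right s' r' hrs'

/-- Homomorphisms `h w` that embed complements of `strictSup F w` in `F w` identify the direct sum
of their domains with the union of the `F w`. -/
lemma toModule_injective_of_split {N : Type u} [AddCommGroup N] [Module S N] {W : Type u}
    [LinearOrder W] [WellFoundedLT W] {F : W → Submodule S N} (hF : Monotone F)
    (X : W → Type u) [∀ w, AddCommGroup (X w)] [∀ w, Module S (X w)] (h : ∀ w, X w →ₗ[S] N)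
    (hmem : ∀ w x, h w x ∈ F w) (hinj : ∀ w x, h w x ∈ strictSup F w → x = 0)
    (hsurj : ∀ w, ∀ b ∈ F w, ∃ x, b - h w x ∈ strictSup F w) [DecidableEq W] :
    Function.Injective (DirectSum.toModule S W N h) ∧
      ∀ w, F w ≤ LinearMap.range (DirectSum.toModule S W N h) := by
  classical
  constructor
  · rw [← LinearMap.ker_eq_bot, LinearMap.ker_eq_bot']
    intro x hx
    by_contra hx0
    have hne : (DFinsupp.support x).Nonempty :=
      Finset.nonempty_iff_ne_empty.2 fun h => hx0 (DFinsupp.support_eq_empty.1 h)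
    -- The component at the largest index of the support is minus the sum of the lower ones.
    set i := (DFinsupp.support x).max' hne with hi
    have hmax : i ∈ DFinsupp.support x := (DFinsupp.support x).max'_mem hne
    refine DFinsupp.mem_support_iff.1 hmax (hinj i _ ?_)
    rw [← DirectSum.sum_support_of x, map_sum, ← Finset.add_sum_erase _ _ hmax,
      add_eq_zero_iff_eq_neg] at hx
    have e : ∀ j, DirectSum.toModule S W N h (DirectSum.of X j (x j)) = h j (x j) := fun j =>
      DirectSum.toModule_lof S j (x j)
    simp only [e] at hx
    rw [hx]
    refine neg_mem (sum_mem fun j hj => (mem_strictSup hF).2 (Or.inr ⟨j, ?_, hmem j _⟩))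
    exact lt_of_le_of_ne ((DFinsupp.support x).le_max' j (Finset.mem_of_mem_erase hj))
      (Finset.ne_of_mem_erase hj)
  · intro w
    induction w using WellFoundedLT.induction with
    | ind w ih =>
      intro b hb
      obtain ⟨x, hx⟩ := hsurj w b hb
      have h1 : b - h w x ∈ LinearMap.range (DirectSum.toModule S W N h) := by
        obtain h0 | ⟨v, hv, hbv⟩ := (mem_strictSup hF).1 hx
        · rw [h0]; exact zero_mem _
        · exact ih v hv hbv
      have h2 : h w x ∈ LinearMap.range (DirectSum.toModule S W N h) :=
        ⟨DirectSum.lof S W X w x, DirectSum.toModule_lof S w x⟩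
      simpa using add_mem h1 h2

/-- If all factors of a tower are direct summands of direct sums of copies of a strong splitter,
then every step of the tower splits. -/
lemma IsTower.exists_split {C : ObjectProperty (ModuleCat.{u} S)} {M : Type u} [AddCommGroup M]
    [Module S M] (hM : ∀ I : Type u, LiftsAlong (S := S) M (I →₀ M))
    (hC : ∀ X : ModuleCat.{u} S, C X → IsCopowerRetract (S := S) M X)
    {N : Type u} [AddCommGroup N] [Module S N] {W : Type u}
    [LinearOrder W] [WellFoundedLT W] {F : W → Submodule S N} (hF : IsTower C F) (w : W) :
    ∃ X : ModuleCat.{u} S, C X ∧ ∃ h : X →ₗ[S] N, (∀ x, h x ∈ F w) ∧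
      (∀ x, h x ∈ strictSup F w → x = 0) ∧ ∀ b ∈ F w, ∃ x, b - h x ∈ strictSup F w := by
  classical
  induction w using WellFoundedLT.induction with
  | ind w ih =>
    choose X hX h hmem hinj hsurj using fun v : Set.Iio w => ih v v.2
    have mono : Monotone fun v : Set.Iio w => F v := fun a b hab => hF.mono hab
    have sup : ∀ v : Set.Iio w, strictSup (fun v : Set.Iio w => F v) v = strictSup F v := by
      intro v
      ext x
      rw [mem_strictSup mono, mem_strictSup hF.mono]
      exact or_congr_right ⟨fun ⟨a, ha, hx⟩ => ⟨a, ha, hx⟩,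
        fun ⟨a, ha, hx⟩ => ⟨⟨a, ha.trans v.2⟩, ha, hx⟩⟩
    obtain ⟨inj, surj⟩ := toModule_injective_of_split mono (fun v => X v) h hmem
      (fun v => sup v ▸ hinj v) (fun v => sup v ▸ hsurj v)
    have range_eq : LinearMap.range (DirectSum.toModule S (Set.Iio w) N h) = strictSup F w := by
      refine le_antisymm ?_ (iSup_le surj)
      rintro _ ⟨x, rfl⟩
      induction x using DirectSum.induction_on with
      | zero => rw [map_zero]; exact zero_mem _
      | of v x =>
        have : DirectSum.toModule S (Set.Iio w) N h (DirectSum.of (fun v => X v) v x) = h v x :=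
          DirectSum.toModule_lof (M := fun v => X v) (φ := h) S v x
        rw [this]
        exact (mem_strictSup hF.mono).2 (Or.inr ⟨v, v.2, hmem v x⟩)
      | add x y hx hy => rw [map_add]; exact add_mem hx hy
    have le : strictSup F w ≤ F w := iSup_le fun v => hF.mono v.2.le
    obtain ⟨Z, hZ, p, hp, hp0⟩ := hF.step w
    let i : DirectSum (Set.Iio w) (fun v => X v) →ₗ[S] F w :=
      (DirectSum.toModule S (Set.Iio w) N h).codRestrict (F w) fun x =>
        le (range_eq ▸ ⟨x, rfl⟩)
    have lifts := (hC Z hZ).liftsAlong hM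
      (isCopowerRetract_directSum M (fun v => X v) fun v => hC _ (hX v))
    obtain ⟨g, hg⟩ := lifts (F w) Z i p (fun a b hab => inj (congrArg Subtype.val hab)) hp (by
      intro b
      rw [hp0, ← range_eq]
      exact ⟨fun ⟨x, hx⟩ => ⟨x, Subtype.ext hx⟩, fun ⟨x, hx⟩ => ⟨x, congrArg Subtype.val hx⟩⟩)
      LinearMap.id
    have hg' : ∀ z, p (g z) = z := LinearMap.congr_fun hg
    refine ⟨Z, hZ, (F w).subtype ∘ₗ g, fun x => (g x).2, fun x hx => ?_, fun b hb => ?_⟩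
    · rw [← hg' x]
      exact (hp0 _).2 hx
    · refine ⟨p ⟨b, hb⟩, (hp0 (⟨b, hb⟩ - g (p ⟨b, hb⟩))).1 ?_⟩
      rw [map_sub, hg', sub_self]

lemma HasTower.exists_directSum {C : ObjectProperty (ModuleCat.{u} S)} {M : Type u}
    [AddCommGroup M] [Module S M] (hM : ∀ I : Type u, LiftsAlong (S := S) M (I →₀ M))
    (hC : ∀ X : ModuleCat.{u} S, C X → IsCopowerRetract (S := S) M X)
    {N : Type u} [AddCommGroup N] [Module S N] (hN : HasTower C N) :
    ∃ (W : Type u) (X : W → ModuleCat.{u} S), (∀ w, C (X w)) ∧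
      Nonempty (N ≃ₗ[S] DirectSum W fun w => X w) := by
  classical
  obtain ⟨W, _, _, F, hF⟩ := hN
  choose X hX h hmem hinj hsurj using hF.exists_split hM hC
  obtain ⟨inj, surj⟩ :=
    toModule_injective_of_split hF.mono (fun w => X w) h hmem hinj hsurj
  refine ⟨W, X, hX, ⟨(LinearEquiv.ofBijective _ ⟨inj, fun x => ?_⟩).symm⟩⟩
  by_cases hx : x = 0
  · exact ⟨0, by rw [hx, map_zero]⟩
  · obtain ⟨w, hw⟩ := hF.exists_mem x hx
    exact surj w hw

end Lifting

/-! ### Cardinalities of direct sums -/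

section Card

variable {S : Type u} [Ring S]

lemma mk_finset_le_of_le {α : Type u} {κ : Cardinal.{u}} (hκ : ℵ₀ ≤ κ) (h : #α ≤ κ) :
    #(Finset α) ≤ κ := by
  rcases finite_or_infinite α with _ | _
  · exact (Cardinal.mk_le_aleph0).trans hκ
  · rwa [Cardinal.mk_finset_of_infinite]

lemma mk_directSum_le {I : Type u} (X : I → Type u) [∀ i, AddCommGroup (X i)] {κ : Cardinal.{u}}
    (hκ : ℵ₀ ≤ κ) (hI : #I ≤ κ) (hX : ∀ i, #(X i) ≤ κ) : #(DirectSum I X) ≤ κ := by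
  classical
  have hsig : #(Σ i, X i) ≤ κ := by
    rw [Cardinal.mk_sigma]
    exact (Cardinal.sum_le_sum _ (fun _ => κ) hX).trans (by
      rw [Cardinal.sum_const']
      exact (mul_le_mul_left hI κ).trans (Cardinal.mul_eq_self hκ).le)
  refine (Cardinal.mk_le_of_injective (f := fun x : DirectSum I X =>
    (DFinsupp.support x).image fun i => (⟨i, x i⟩ : Σ i, X i)) fun x y hxy => ?_).trans
    (mk_finset_le_of_le hκ hsig)
  -- A nonzero component of one of the two elements is recorded in the common graph.
  have aux : ∀ x y : DirectSum I X, ((DFinsupp.support x).image fun i => (⟨i, x i⟩ : Σ i, X i)) =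
      ((DFinsupp.support y).image fun i => (⟨i, y i⟩ : Σ i, X i)) → ∀ i, x i ≠ 0 → x i = y i := by
    intro x y hxy i hi
    have hmem : (⟨i, x i⟩ : Σ i, X i) ∈ (DFinsupp.support x).image fun i => (⟨i, x i⟩ : Σ i, X i) :=
      Finset.mem_image_of_mem _ (DFinsupp.mem_support_iff.2 hi)
    rw [hxy, Finset.mem_image] at hmem
    obtain ⟨j, -, hj⟩ := hmem
    obtain ⟨rfl, h⟩ := Sigma.mk.inj_iff.1 hj
    exact (eq_of_heq h).symm
  refine DFinsupp.ext fun i => ?_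
  by_cases hx : x i = 0
  · by_cases hy : y i = 0
    · exact hx.trans hy.symm
    · exact (aux y x hxy.symm i hy).symm
  · exact aux x y hxy i hx

lemma le_mk_directSum {I J : Type u} (X : I → Type u) [∀ i, AddCommGroup (X i)] (f : J → I)
    (hf : Function.Injective f) (h : ∀ j, Nontrivial (X (f j))) : #J ≤ #(DirectSum I X) := by
  classical
  choose x hx using fun j => exists_ne (0 : X (f j))
  refine Cardinal.mk_le_of_injective (f := fun j => DirectSum.of X (f j) (x j)) fun j k hjk => ?_
  by_contra hne
  have h1 : DirectSum.of X (f j) (x j) (f j) = DirectSum.of X (f k) (x k) (f j) :=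
    congrArg (fun z : DirectSum I X => z (f j)) hjk
  rw [DirectSum.of_eq_same, DirectSum.of_eq_of_ne _ _ _ (fun h => hne (hf h))] at h1
  exact hx j h1

lemma mk_le_of_isLTPresented {κ : Cardinal.{u}} (hκ : ℵ₀ ≤ κ) (hS : #S ≤ κ)
    {X : ModuleCat.{u} S} (hX : IsLTPresented (Order.succ κ) X) : #X ≤ κ := by
  classical
  obtain ⟨P, hG, -⟩ := hX
  refine (Cardinal.mk_le_of_surjective P.toIsPresentation.surjective_π).trans ?_
  refine (Cardinal.mk_le_of_injective (finsuppLEquivDirectSum S S P.G).injective).trans ?_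
  exact mk_directSum_le _ hκ (Order.lt_succ_iff.1 hG) fun _ => hS

lemma mk_copower (M : ModuleCat.{u} S) [Nontrivial M] {μ : Cardinal.{u}} (hμ : ℵ₀ ≤ μ)
    (hM : #M ≤ μ) : #(copower M μ.out) = μ := by
  have : Infinite μ.out := Cardinal.infinite_iff.2 (by rwa [Cardinal.mk_out])
  change #(μ.out →₀ M) = μ
  rw [Cardinal.mk_finsupp_of_infinite, Cardinal.mk_out, max_eq_left hM]

/-- Zero summands may be left out of a direct sum. -/
lemma nonempty_directSum_equiv_nontrivial {I : Type u} (X : I → Type u) [∀ i, AddCommGroup (X i)]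
    [∀ i, Module S (X i)] :
    Nonempty (DirectSum I X ≃ₗ[S] DirectSum {i // Nontrivial (X i)} fun i => X i) := by
  classical
  refine ⟨LinearEquiv.ofLinearMap
    (DirectSum.toModule S I _ fun i => if h : Nontrivial (X i) then
      DirectSum.lof S {i // Nontrivial (X i)} (fun i => X i) ⟨i, h⟩ else 0)
    (DirectSum.toModule S _ _ fun i : {i // Nontrivial (X i)} => DirectSum.lof S I X i) ?_ ?_⟩
  · refine DirectSum.linearMap_ext S fun i => LinearMap.ext fun x => ?_
    simp [i.2]
  · refine DirectSum.linearMap_ext S fun i => LinearMap.ext fun x => ?_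
    by_cases h : Nontrivial (X i)
    · simp [h]
    · rw [not_nontrivial_iff_subsingleton] at h
      rw [Subsingleton.elim x 0, map_zero, map_zero]

end Card

/-! ### Categoricity -/

section Categoricity

variable {S : Type u} [Ring S]

lemma filt_of_equiv {C : ObjectProperty (ModuleCat.{u} S)} {N N' : ModuleCat.{u} S}
    (e : N ≃ₗ[S] N') (h : Filt C N) : Filt C N' :=
  ((hasTower_of_filt h).of_equiv e).filt

lemma filt_directSum {C : ObjectProperty (ModuleCat.{u} S)} {I : Type u}
    (N : I → ModuleCat.{u} S) (h : ∀ i, Filt C (N i)) :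
    Filt C (ModuleCat.of S (DirectSum I fun i => N i)) :=
  HasTower.filt (hasTower_directSum (fun i => N i) fun i => hasTower_of_filt (h i))

lemma filt_copower {C : ObjectProperty (ModuleCat.{u} S)} {M : ModuleCat.{u} S} (h : Filt C M)
    (I : Type u) : Filt C (copower M I) := by
  classical
  exact filt_of_equiv (N := ModuleCat.of S (DirectSum I fun _ => M))
    (finsuppLEquivDirectSum S M I).symm (filt_directSum (fun _ => M) fun _ => h)

/-- If the filtered modules of cardinality `l` are pairwise isomorphic, then every small member `X`
of the filtering class is a direct summand of a direct sum of copies of `M`: both `X ⊕ M^(l)` and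
`M^(l)` are filtered and of cardinality `l`. -/
lemma isCopowerRetract_of_isCategoricalIn {C : ObjectProperty (ModuleCat.{u} S)}
    {M : ModuleCat.{u} S} [Nontrivial M] (hM : Filt C M) {l : Cardinal.{u}} (hl : ℵ₀ ≤ l)
    (hMl : #M ≤ l) (hcat : IsCategoricalIn (Filt C) l) {X : ModuleCat.{u} S} (hX : Filt C X)
    (hXl : #X ≤ l) : IsCopowerRetract (S := S) M X := by
  classical
  let Y : Option l.out → ModuleCat.{u} S := fun o => o.elim X fun _ => M
  have hY : ∀ o, Filt C (Y o) := fun o => by cases o <;> assumption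
  have hYl : ∀ o, #(Y o) ≤ l := fun o => by cases o <;> assumption
  have card : #(DirectSum _ fun o => Y o) = l := by
    refine le_antisymm (mk_directSum_le _ hl ?_ hYl) ?_
    · rw [Cardinal.mk_option, Cardinal.mk_out]
      exact (Cardinal.add_one_eq hl).le
    · have := le_mk_directSum (fun o => Y o) (Option.some : l.out → _) (Option.some_injective _)
        fun _ => ‹Nontrivial M›
      rwa [Cardinal.mk_out] at this
  obtain ⟨e⟩ := hcat.2 (ModuleCat.of S (DirectSum _ fun o => Y o)) (copower M l.out)
    (filt_directSum Y hY) (filt_copower hM _) card (mk_copower M hl hMl)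
  let e' : DirectSum _ (fun o => Y o) ≃ₗ[S] (l.out →₀ M) := e
  refine ⟨l.out, e'.toLinearMap ∘ₗ DirectSum.lof S _ (fun o => Y o) none,
    DirectSum.component S _ (fun o => Y o) none ∘ₗ e'.symm.toLinearMap, LinearMap.ext fun x => ?_⟩
  change DirectSum.component S _ (fun o => Y o) none (e'.symm (e' (DirectSum.lof S _ _ none x))) = x
  rw [LinearEquiv.symm_apply_apply]
  exact DirectSum.component.lof_self S (M := fun o => Y o) none x

/-- A direct sum of `μ` nonzero modules, split into `μ` groups of `l` summands each, is a direct sum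
of copies of `M` if `M^(l)` is the only filtered module of cardinality `l`. -/
lemma nonempty_directSum_equiv_copower {C : ObjectProperty (ModuleCat.{u} S)}
    {M : ModuleCat.{u} S} [Nontrivial M] (hM : Filt C M) {l μ : Cardinal.{u}} (hl : ℵ₀ ≤ l)
    (hMl : #M ≤ l) (hcat : IsCategoricalIn (Filt C) l) (hlμ : l ≤ μ) {I : Type u} (hI : #I = μ)
    (X : I → ModuleCat.{u} S) (hX : ∀ i, Filt C (X i)) (hXl : ∀ i, #(X i) ≤ l)
    (hX0 : ∀ i, Nontrivial (X i)) :
    Nonempty (DirectSum I (fun i => X i) ≃ₗ[S] copower M μ.out) := by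
  classical
  have card : #(μ.out × l.out) = μ := by
    rw [Cardinal.mk_prod, Cardinal.lift_id, Cardinal.lift_id, Cardinal.mk_out, Cardinal.mk_out,
      Cardinal.mul_eq_left (hl.trans hlμ) hlμ (Cardinal.aleph0_pos.trans_le hl).ne']
  obtain ⟨e⟩ := Cardinal.eq.1 (hI.trans card.symm)
  obtain ⟨e'⟩ := Cardinal.eq.1 (card.trans (Cardinal.mk_out μ).symm)
  let e₁ : I ≃ (Σ _ : μ.out, l.out) := e.trans (Equiv.sigmaEquivProd _ _).symm
  have block : ∀ a, Nonempty
      (DirectSum l.out (fun b => X (e₁.symm ⟨a, b⟩)) ≃ₗ[S] (l.out →₀ M)) := fun a => by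
    refine hcat.2 (ModuleCat.of S (DirectSum l.out fun b => X (e₁.symm ⟨a, b⟩))) (copower M l.out)
      (filt_directSum _ fun b => hX _) (filt_copower hM _) ?_ (mk_copower M hl hMl)
    refine le_antisymm (mk_directSum_le _ hl (Cardinal.mk_out l).le fun b => hXl _) ?_
    have := le_mk_directSum (fun b => X (e₁.symm ⟨a, b⟩)) id Function.injective_id fun b => hX0 _
    rwa [Cardinal.mk_out] at this
  have f := fun a => (block a).some
  exact ⟨(DirectSum.lequivCongrLeft S e₁).trans <|
    (DirectSum.sigmaLcurryEquiv S (δ := fun a b => X (e₁.symm ⟨a, b⟩))).trans <|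
    (DFinsupp.mapRange.linearEquiv f).trans <|
    (finsuppLEquivDirectSum S (l.out →₀ M) μ.out).symm.trans <|
    (Finsupp.curryLinearEquiv S).symm.trans <| Finsupp.domLCongr e'⟩

lemma nonempty_equiv_copower_of_isCategoricalIn {C : ObjectProperty (ModuleCat.{u} S)}
    {M : ModuleCat.{u} S} [Nontrivial M] (hM : Filt C M) (hsplit : IsStrongSplitter M)
    {l : Cardinal.{u}} (hl : ℵ₀ ≤ l) (hMl : #M ≤ l) (hCl : ∀ X, C X → Filt C X ∧ #X ≤ l)
    (hcat : IsCategoricalIn (Filt C) l) {μ : Cardinal.{u}} (hlμ : l ≤ μ) {N : ModuleCat.{u} S}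
    (hN : Filt C N) (hNμ : #N = μ) : Nonempty (N ≃ₗ[S] copower M μ.out) := by
  obtain rfl | hlt := hlμ.eq_or_lt
  · exact hcat.2 N _ hN (filt_copower hM _) hNμ (mk_copower M hl hMl)
  have hsplit' : ∀ I : Type u, LiftsAlong (S := S) M (I →₀ M) := fun I =>
    liftsAlong_of_ext M (copower M I) (hsplit I)
  obtain ⟨W, X, hX, ⟨e⟩⟩ := (hasTower_of_filt hN).exists_directSum hsplit' fun X hX =>
    isCopowerRetract_of_isCategoricalIn hM hl hMl hcat (hCl X hX).1 (hCl X hX).2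
  obtain ⟨e'⟩ := nonempty_directSum_equiv_nontrivial (S := S) fun w => X w
  have hcard : #(DirectSum {w // Nontrivial (X w)} fun w => X w) = μ := by
    rw [← hNμ, Cardinal.mk_congr (e.trans e').toEquiv]
  -- Modules of cardinality at most `l < μ` add up to `μ` only if there are `μ` of them.
  have hW : #{w // Nontrivial (X w)} = μ := by
    refine le_antisymm ?_ (le_of_not_gt fun hlt' => ?_)
    · rw [← hcard]
      exact le_mk_directSum (fun w : {w // Nontrivial (X w)} => X w) id Function.injective_id
        fun w => w.2
    · have := mk_directSum_le (fun w : {w // Nontrivial (X w)} => X w)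
        (hl.trans (le_max_right #{w // Nontrivial (X w)} l)) (le_max_left _ _)
        fun w => (hCl _ (hX w)).2.trans (le_max_right _ _)
      rw [hcard] at this
      exact absurd this (not_le.2 (max_lt hlt' hlt))
  obtain ⟨e''⟩ := nonempty_directSum_equiv_copower hM hl hMl hcat hlμ hW (fun w => X w)
    (fun w => (hCl _ (hX w)).1) (fun w => (hCl _ (hX w)).2) fun w => w.2
  exact ⟨(e.trans e').trans e''⟩

end Categoricity

/-- Right `R`-modules are Mathlib's modules over `Rᵐᵒᵖ`. -/
theorem lemma3p5 {R : Type u} [Ring R]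
    (D : ObjectProperty (ModuleCat.{u} Rᵐᵒᵖ))
    (M : ModuleCat.{u} Rᵐᵒᵖ) (hMD : D M) (hM0 : Nontrivial M) (hM : IsStrongSplitter M)
    (κ : Cardinal.{u}) (hκ : ℵ₀ ≤ κ) (hRM : #R + #M ≤ κ)
    (hD : IsDeconstructible (Order.succ κ) D)
    (l : Cardinal.{u}) (hl : κ ≤ l) :
    List.TFAE [
      ∀ μ : Cardinal.{u}, l ≤ μ → IsCategoricalIn D μ,
      IsCategoricalIn D l,
      ∀ μ : Cardinal.{u}, l ≤ μ → ∀ N : ModuleCat.{u} Rᵐᵒᵖ, D N → #N = μ →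
        Nonempty (N ≃ₗ[Rᵐᵒᵖ] copower M μ.out)] := by
  obtain ⟨-, C, -, hCD, hC, rfl⟩ := hD
  have hl0 : ℵ₀ ≤ l := hκ.trans hl
  have hR : #Rᵐᵒᵖ ≤ κ := by
    rw [← Cardinal.mk_congr (MulOpposite.opEquiv (α := R))]
    exact (self_le_add_right _ _).trans hRM
  have hMl : #M ≤ l := ((self_le_add_left _ _).trans hRM).trans hl
  have hCl : ∀ X, C X → Filt C X ∧ #X ≤ l := fun X hX =>
    ⟨hCD X hX, (mk_le_of_isLTPresented hκ hR (hC X hX)).trans hl⟩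
  tfae_have 1 → 2 := fun h => h l le_rfl
  tfae_have 2 → 3 := fun h μ hμ N hN hNμ =>
    nonempty_equiv_copower_of_isCategoricalIn hMD hM hl0 hMl hCl h hμ hN hNμ
  tfae_have 3 → 1 := fun h μ hμ =>
    ⟨⟨copower M μ.out, filt_copower hMD _, mk_copower M (hl0.trans hμ) (hMl.trans hμ)⟩,
      fun N N' hN hN' hNμ hNμ' => by
        obtain ⟨e⟩ := h μ hμ N hN hNμ
        obtain ⟨e'⟩ := h μ hμ N' hN' hNμ'
        exact ⟨e.trans e'.symm⟩⟩
  tfae_finish
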